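/- Let $\mathcal H$ and $\mathcal K$ be complex Hilbert spaces, let $A\colon\mathcal H\to\mathcal K$ be a bounded linear operator, and let $B$ and $C$ be positive (selfadjoint) bounded linear operators on $\mathcal H$ and on $\mathcal K$, respectively. Let $\alpha,\beta$ be distinct positive real numbers. Then the following conditions are equivalent: (i) $A^*A\le B$ and $A^*C^sA=B^{s+1}$ for $s=\alpha$ and $s=\beta$; (ii) $A^*A=B$ and $AB=CA$. Here $\le$ is the usual order on selfadjoint operators ($S\le T$ if and only if $T-S$ is positive), and real powers of positive operators are defined by the functional calculus. The operator $B$ is not assumed to be injective. -/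

import Mathlib

/-!
If `A⋆A = B` and `AB = CA`, then `A f(B) = f(C) A` for every continuous `f`, so that
`A⋆CˢA = A⋆ABˢ = Bˢ⁺¹`; the content is the converse.

Let `α < β` and put `p = α / β ∈ (0, 1)`, `Y = C ^ β`, `Z = B ^ β`. The hypotheses read `A⋆A ≤ B`,
`A⋆YA = BZ` and `A⋆YᵖA = BZᵖ`: the last one is the equality case of an operator Jensen inequality
for the operator concave function `x ↦ xᵖ`. For `x ∈ H` and `t > 0` set `s = (t + Z)⁻¹x` and
`r = (t + Y)⁻¹Ax`. Completing a square shows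
`t² ‖As - r‖² ≤ re ⟪x - ts, Bx⟫ - re ⟪Ax - tr, Ax⟫` (`sq_norm_sub_le`). Up to a positive factor, the
right-hand side is the integrand of `re ⟪Zᵖx, Bx⟫ - re ⟪YᵖAx, Ax⟫ = 0` in the integral representation
of the `p`-th power (`integral_cfc_rpowIntegrand₀₁`). It is nonnegative and continuous in `t`, so it
vanishes for all `t`; at `t = 1` this gives `A(1 + Z)⁻¹ = (1 + Y)⁻¹A`, that is `AZ = YA`
(`comp_eq_of_adjoint_comp_rpow_comp_eq`). Taking `β⁻¹`-th powers yields `AB = CA`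
(`rpow_comp_of_comp_eq`).

Finally `G = B - A⋆A` satisfies `0 ≤ G ≤ B` and `G Bᵝ = 0`. Hence `GB = 0`, so `G³ ≤ GBG = 0`, and
`G = 0`.
-/

/-! ### Functional calculus in C⋆-algebras -/

section CStar

open scoped NNReal
open MeasureTheory Set Real

variable {𝒜 : Type*} [CStarAlgebra 𝒜]

theorem norm_cfc_sub_aeval_le {a : 𝒜} (ha : IsSelfAdjoint a) {f : ℝ → ℝ} (hf : Continuous f)
    (q : Polynomial ℝ) {δ : ℝ} (hδ : 0 ≤ δ) (h : ∀ x ∈ spectrum ℝ a, |q.eval x - f x| ≤ δ) :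
    ‖cfc f a - Polynomial.aeval a q‖ ≤ δ := by
  rw [← cfc_polynomial q a ha, ← cfc_sub f q.eval a hf.continuousOn q.continuous.continuousOn]
  refine norm_cfc_le hδ fun x hx => ?_
  rw [Real.norm_eq_abs, abs_sub_comm]
  exact h x hx

variable [PartialOrder 𝒜] [StarOrderedRing 𝒜]

/-- Unlike in `CFC.rpow_add`, the element `a` need not be invertible. -/
theorem CFC.rpow_add_one_of_nonneg (a : 𝒜) (ha : 0 ≤ a) {s : ℝ} (hs : 0 < s) :
    a ^ (s + 1) = a * a ^ s := by
  lift s to ℝ≥0 using hs.le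
  have h := CFC.nnrpow_add (a := a) (x := 1) (y := s) one_pos (by exact_mod_cast hs)
  rw [CFC.nnrpow_one a, CFC.nnrpow_eq_rpow (by positivity),
    CFC.nnrpow_eq_rpow (by exact_mod_cast hs)] at h
  rw [← h, NNReal.coe_add, NNReal.coe_one, add_comm]

theorem isUnit_algebraMap_add (a : 𝒜) (ha : 0 ≤ a) {t : ℝ} (ht : 0 < t) :
    IsUnit (algebraMap ℝ 𝒜 t + a) := by
  have h := spectrum_nonneg_of_nonneg ha (x := -t)
  by_contra hu
  have : -t ∈ spectrum ℝ a := by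
    rw [spectrum.mem_iff]
    contrapose! hu
    rw [← IsUnit.neg_iff]
    simpa [sub_eq_add_neg, add_comm] using hu
  linarith [h this]

theorem cfc_rpowIntegrand₀₁_eq (a : 𝒜) (ha : 0 ≤ a) {p t : ℝ} (hp : p ∈ Ioo 0 1)
    (ht : 0 < t) : cfc (rpowIntegrand₀₁ p t) a =
      t ^ (p - 1) • (1 - t • Ring.inverse (algebraMap ℝ 𝒜 t + a)) := by
  have ha' : IsSelfAdjoint a := .of_nonneg ha
  have hs : ∀ z ∈ spectrum ℝ a, t + z ≠ 0 := fun z hz => by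
    have := spectrum_nonneg_of_nonneg ha hz
    positivity
  have hg : ContinuousOn (fun z : ℝ => (t + z)⁻¹) (spectrum ℝ a) := by
    fun_prop (disch := assumption)
  have hf : ContinuousOn (fun z : ℝ => t + z) (spectrum ℝ a) := by fun_prop
  have hc := cfc_const_mul (t ^ p) (fun z : ℝ => (t + z)⁻¹) a hg
  rw [rpowIntegrand₀₁_eq_sub hp.2.ne ht,
    cfc_sub (fun _ : ℝ => t ^ (p - 1)) (fun z : ℝ => t ^ p * (t + z)⁻¹) a continuousOn_const
      (continuousOn_const.mul hg),
    cfc_const .., hc, cfc_inv _ _ hs .., cfc_const_add .., cfc_id' ..,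
    smul_sub, smul_smul, ← rpow_add_one ht.ne', sub_add_cancel, Algebra.algebraMap_eq_smul_one]

theorem continuousOn_cfc_rpowIntegrand₀₁ (a : 𝒜) (ha : 0 ≤ a) {p : ℝ}
    (hp : p ∈ Ioo 0 1) : ContinuousOn (fun t => cfc (rpowIntegrand₀₁ p t) a) (Ioi 0) := by
  have h : ContinuousOn (fun t : ℝ => t ^ (p - 1) •
      (1 - t • Ring.inverse (algebraMap ℝ 𝒜 t + a))) (Ioi 0) := by
    intro t ht
    obtain ⟨u, hu⟩ := isUnit_algebraMap_add a ha ht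
    have h1 : ContinuousAt (fun t : ℝ => Ring.inverse (algebraMap ℝ 𝒜 t + a)) t := by
      have := NormedRing.inverse_continuousAt u
      rw [hu] at this
      exact ContinuousAt.comp (f := fun t : ℝ => algebraMap ℝ 𝒜 t + a) this (by fun_prop)
    have h2 : ContinuousAt (fun t : ℝ => t ^ (p - 1)) t :=
      Real.continuousAt_rpow_const _ _ (.inl (ne_of_gt ht))
    exact (h2.smul (continuousAt_const.sub (continuousAt_id.smul h1))).continuousWithinAt
  exact h.congr fun t ht => cfc_rpowIntegrand₀₁_eq a ha hp ht

/-- The integral representation of `a ^ p` for `0 < p < 1`, with an explicit constant and Lebesgue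
measure, so that it can be compared between different algebras. -/
theorem integral_cfc_rpowIntegrand₀₁ (a : 𝒜) (ha : 0 ≤ a) {p : ℝ} (hp : p ∈ Ioo 0 1) :
    IntegrableOn (fun t => cfc (rpowIntegrand₀₁ p t) a) (Ioi 0) ∧
    ∫ t in Ioi 0, cfc (rpowIntegrand₀₁ p t) a =
      (∫ t in Ioi 0, rpowIntegrand₀₁ p t 1) • a ^ p := by
  have ha' : IsSelfAdjoint a := .of_nonneg ha
  obtain ⟨M, hM⟩ := (spectrum.isCompact (𝕜 := ℝ) a).bddAbove
  have hs : ∀ z ∈ spectrum ℝ a, 0 ≤ z := fun z hz => spectrum_nonneg_of_nonneg ha hz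
  have hf : ContinuousOn (Function.uncurry (rpowIntegrand₀₁ p)) (Ioi 0 ×ˢ spectrum ℝ a) :=
    continuousOn_rpowIntegrand₀₁_uncurry hp _ hs
  have hbound : ∀ᵐ t ∂volume.restrict (Ioi 0), ∀ z ∈ spectrum ℝ a,
      ‖rpowIntegrand₀₁ p t z‖ ≤ rpowIntegrand₀₁ p t (max M 0) := by
    filter_upwards [ae_restrict_mem measurableSet_Ioi] with t ht z hz
    rw [Real.norm_of_nonneg (rpowIntegrand₀₁_nonneg hp.1 (le_of_lt ht) (hs z hz))]
    exact rpowIntegrand₀₁_monotoneOn hp (le_of_lt ht) (hs z hz)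
      (show 0 ≤ max M 0 from le_max_right M 0) ((hM hz).trans (le_max_left _ _))
  have hfin := (integrableOn_rpowIntegrand₀₁_Ioi hp (le_max_right M 0)).2
  refine ⟨integrableOn_cfc measurableSet_Ioi _ _ a hf hbound hfin, ?_⟩
  rw [← cfc_setIntegral measurableSet_Ioi _ _ a hf hbound hfin, CFC.rpow_eq_cfc_real,
    ← cfc_smul _ _ a (Real.continuous_rpow_const hp.1.le).continuousOn]
  refine cfc_congr fun x hx => ?_
  simp only [integral_rpowIntegrand₀₁_eq_rpow_mul_const hp (hs x hx), smul_eq_mul, mul_comm]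

end CStar

/-! ### Intertwining operators and the functional calculus -/

section Intertwining

variable {H K : Type*}
    [NormedAddCommGroup H] [InnerProductSpace ℂ H]
    [NormedAddCommGroup K] [InnerProductSpace ℂ K]

theorem aeval_comp_of_comp_eq (A : H →L[ℂ] K) (a : H →L[ℂ] H) (b : K →L[ℂ] K)
    (h : A.comp a = b.comp A) (q : Polynomial ℝ) :
    A.comp (Polynomial.aeval a q) = (Polynomial.aeval b q).comp A := by
  induction q using Polynomial.induction_on' with
  | add p q hp hq => simp [ContinuousLinearMap.comp_add, ContinuousLinearMap.add_comp, hp, hq]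
  | monomial n r =>
    have hpow : A.comp (a ^ n) = (b ^ n).comp A := by
      induction n with
      | zero => ext; simp
      | succ n ih =>
        rw [pow_succ, pow_succ', ContinuousLinearMap.mul_def, ← ContinuousLinearMap.comp_assoc, ih,
          ContinuousLinearMap.comp_assoc, h, ← ContinuousLinearMap.comp_assoc,
          ← ContinuousLinearMap.mul_def, ← pow_succ, pow_succ']
    rw [Polynomial.aeval_monomial, Polynomial.aeval_monomial, ← Algebra.smul_def,
      ← Algebra.smul_def]
    ext x
    simpa using congrArg (fun z => r • z) (DFunLike.congr_fun hpow x)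

variable [CompleteSpace H] [CompleteSpace K]

/-- An operator intertwining two selfadjoint operators intertwines their functional calculi, by
uniform polynomial approximation on an interval containing both spectra. -/
theorem cfc_comp_of_comp_eq (A : H →L[ℂ] K) (a : H →L[ℂ] H) (b : K →L[ℂ] K)
    (ha : IsSelfAdjoint a) (hb : IsSelfAdjoint b) (h : A.comp a = b.comp A)
    (f : ℝ → ℝ) (hf : Continuous f) : A.comp (cfc f a) = (cfc f b).comp A := by
  rw [← sub_eq_zero, ← norm_eq_zero]
  obtain ⟨M, hM⟩ := ((spectrum.isCompact (𝕜 := ℝ) a).union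
    (spectrum.isCompact (𝕜 := ℝ) b)).isBounded.subset_closedBall 0
  rw [Real.closedBall_eq_Icc] at hM
  refine le_antisymm (le_of_forall_pos_le_add fun ε hε => ?_) (norm_nonneg _)
  have hδ : 0 < ε / (2 * (‖A‖ + 1)) := by positivity
  obtain ⟨q, hq⟩ := exists_polynomial_near_of_continuousOn _ _ f hf.continuousOn _ hδ
  have h1 := norm_cfc_sub_aeval_le ha hf q hδ.le
    fun x hx => (hq x (hM (Set.subset_union_left hx))).le
  have h2 := norm_cfc_sub_aeval_le hb hf q hδ.le
    fun x hx => (hq x (hM (Set.subset_union_right hx))).le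
  have e : A.comp (cfc f a) - (cfc f b).comp A =
      A.comp (cfc f a - Polynomial.aeval a q) - (cfc f b - Polynomial.aeval b q).comp A := by
    rw [ContinuousLinearMap.comp_sub, ContinuousLinearMap.sub_comp, aeval_comp_of_comp_eq A a b h q]
    abel
  rw [e, zero_add]
  calc _ ≤ ‖A‖ * (ε / (2 * (‖A‖ + 1))) + (ε / (2 * (‖A‖ + 1))) * ‖A‖ := by
        refine (norm_sub_le _ _).trans (add_le_add ?_ ?_)
        · exact (ContinuousLinearMap.opNorm_comp_le _ _).trans (by gcongr)
        · exact (ContinuousLinearMap.opNorm_comp_le _ _).trans (by gcongr)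
    _ = ε * (‖A‖ / (‖A‖ + 1)) := by field_simp; ring
    _ ≤ ε := mul_le_of_le_one_right hε.le (by rw [div_le_one (by positivity)]; linarith)

theorem rpow_comp_of_comp_eq (A : H →L[ℂ] K) (a : H →L[ℂ] H) (b : K →L[ℂ] K)
    (ha : 0 ≤ a) (hb : 0 ≤ b) (h : A.comp a = b.comp A) {s : ℝ} (hs : 0 < s) :
    A.comp (a ^ s) = (b ^ s).comp A := by
  rw [CFC.rpow_eq_cfc_real, CFC.rpow_eq_cfc_real]
  exact cfc_comp_of_comp_eq A a b (.of_nonneg ha) (.of_nonneg hb) h _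
    (Real.continuous_rpow_const hs.le)

end Intertwining

/-! ### The equality case of the operator Jensen inequality for powers -/

section Equality

open scoped InnerProductSpace
open MeasureTheory Set Real ContinuousLinearMap

variable {H K : Type*}
    [NormedAddCommGroup H] [InnerProductSpace ℂ H] [CompleteSpace H]
    [NormedAddCommGroup K] [InnerProductSpace ℂ K] [CompleteSpace K]

/-- The resolvent form of the Jensen inequality, with an error term that controls the equality case.
Here `s = (t + Z)⁻¹ x` and `r = (t + Y)⁻¹ (A x)`. With `d = A s - r`, the difference of the two sides
is `⟪(B - A⋆A) Z s, Z s⟫ + t ⟪Y d, d⟫`. -/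
theorem sq_norm_sub_le (A : H →L[ℂ] K) (B Z : H →L[ℂ] H) (Y : K →L[ℂ] K)
    (hY : 0 ≤ Y) (hAB : (adjoint A).comp A ≤ B)
    (hYZ : (adjoint A).comp (Y.comp A) = B * Z) {t : ℝ} (ht : 0 < t) {x s : H} {r : K}
    (hs : (t : ℂ) • s + Z s = x) (hr : (t : ℂ) • r + Y r = A x) :
    t ^ 2 * ‖A s - r‖ ^ 2 ≤
      RCLike.re ⟪x - (t : ℂ) • s, B x⟫_ℂ - RCLike.re ⟪A x - (t : ℂ) • r, A x⟫_ℂ := by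
  have hB : 0 ≤ B := le_trans ((nonneg_iff_isPositive _).2 (isPositive_adjoint_comp_self A)) hAB
  rw [nonneg_iff_isPositive] at hY hB
  obtain ⟨d, hd⟩ : ∃ d, d = A s - r := ⟨_, rfl⟩
  have hAs : A s = d + r := by rw [hd]; abel
  have hw : A (Z s) = Y r - (t : ℂ) • d := by
    rw [← hs, map_add, map_smul, hAs, smul_add] at hr
    rw [eq_sub_iff_add_eq]
    refine (add_left_cancel (a := (t : ℂ) • r) (hr.trans ?_)).symm
    abel
  have h1 : 0 ≤ RCLike.re ⟪Z s, B (Z s)⟫_ℂ - RCLike.re ⟪A (Z s), A (Z s)⟫_ℂ := by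
    have := ((le_def _ _).1 hAB).re_inner_nonneg_right (Z s)
    rwa [sub_apply, inner_sub_right, coe_comp, Function.comp_apply, adjoint_inner_right,
      map_sub] at this
  have h2 := hY.re_inner_nonneg_right d
  have h3 : ⟪Z s, B s⟫_ℂ = ⟪Y (A s), A s⟫_ℂ := by
    rw [← adjoint_inner_left A, ← hB.inner_left_eq_inner_right]
    exact congrArg (inner ℂ · s) (DFunLike.congr_fun hYZ s).symm
  have h4 : RCLike.re ⟪Y d, r⟫_ℂ = RCLike.re ⟪Y r, d⟫_ℂ := by
    rw [hY.inner_left_eq_inner_right, inner_re_symm]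
  have h5 : RCLike.re ⟪d, Y d⟫_ℂ = RCLike.re ⟪Y d, d⟫_ℂ := inner_re_symm _ _
  have h6 : RCLike.re ⟪d, Y r⟫_ℂ = RCLike.re ⟪Y r, d⟫_ℂ := inner_re_symm _ _
  have e1 : x - (t : ℂ) • s = Z s := by rw [← hs]; abel
  have e2 : A x - (t : ℂ) • r = Y r := by rw [← hr]; abel
  have h3' := congrArg RCLike.re h3
  have h7 : ‖d‖ ^ 2 = RCLike.re ⟪d, d⟫_ℂ := (inner_self_eq_norm_sq d).symm
  rw [hw] at h1
  rw [e1, e2, ← hr, ← hs, ← hd, h7]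
  rw [hAs] at h3'
  simp only [map_add, map_smul, inner_add_left, inner_add_right, inner_sub_left, inner_sub_right,
    inner_smul_left, inner_smul_right, map_sub, Complex.conj_ofReal, RCLike.re_to_complex,
    Complex.sub_re, Complex.re_ofReal_mul] at *
  -- It remains to subtract `h1` and `t` times `h2`: what is left is `t² ‖d‖²`.
  rw [h6] at h1
  rw [h5] at h2
  rw [h3', h4]
  linarith [mul_nonneg ht.le h2]

/-- Equality in the Jensen inequality `A⋆ Yᵖ A ≤ B Zᵖ` (of quadratic forms) forces `A` to intertwine
`Z` and `Y`. The operators `B` and `Z` need not be assumed to commute. -/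
theorem comp_eq_of_adjoint_comp_rpow_comp_eq (A : H →L[ℂ] K) (B Z : H →L[ℂ] H) (Y : K →L[ℂ] K)
    (hZ : 0 ≤ Z) (hY : 0 ≤ Y) (hAB : (adjoint A).comp A ≤ B)
    (hYZ : (adjoint A).comp (Y.comp A) = B * Z) {p : ℝ} (hp : p ∈ Ioo 0 1)
    (hYZp : (adjoint A).comp ((Y ^ p).comp A) = B * Z ^ p) :
    A.comp Z = Y.comp A := by
  have key : ∀ (x : H) (t : ℝ), 0 < t →
      t ^ (p - 1) * (t ^ 2 * ‖A (Ring.inverse (algebraMap ℝ (H →L[ℂ] H) t + Z) x) -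
        Ring.inverse (algebraMap ℝ (K →L[ℂ] K) t + Y) (A x)‖ ^ 2) ≤
      RCLike.re ⟪cfc (rpowIntegrand₀₁ p t) Z x, B x⟫_ℂ -
        RCLike.re ⟪cfc (rpowIntegrand₀₁ p t) Y (A x), A x⟫_ℂ := by
    intro x t ht
    rw [cfc_rpowIntegrand₀₁_eq Z hZ hp ht, cfc_rpowIntegrand₀₁_eq Y hY hp ht]
    have hs := DFunLike.congr_fun
      (Ring.mul_inverse_cancel _ (isUnit_algebraMap_add Z hZ ht)) x
    have hr := DFunLike.congr_fun
      (Ring.mul_inverse_cancel _ (isUnit_algebraMap_add Y hY ht)) (A x)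
    set S := Ring.inverse (algebraMap ℝ (H →L[ℂ] H) t + Z)
    set R := Ring.inverse (algebraMap ℝ (K →L[ℂ] K) t + Y)
    have h := sq_norm_sub_le A B Z Y hY hAB hYZ ht (x := x) (s := S x) (r := R (A x)) hs hr
    -- The real scalar action on operators is definitionally the complex one.
    have e1 : (t ^ (p - 1) • (1 - t • S)) x = ((t ^ (p - 1) : ℝ) : ℂ) • (x - (t : ℂ) • S x) := rfl
    have e2 : (t ^ (p - 1) • (1 - t • R)) (A x) =
        ((t ^ (p - 1) : ℝ) : ℂ) • (A x - (t : ℂ) • R (A x)) := rfl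
    rw [e1, e2, inner_smul_left, inner_smul_left, Complex.conj_ofReal, RCLike.re_to_complex,
      RCLike.re_to_complex, Complex.re_ofReal_mul, Complex.re_ofReal_mul, ← mul_sub]
    exact mul_le_mul_of_nonneg_left h (by positivity)
  have heq : A.comp (Ring.inverse (algebraMap ℝ (H →L[ℂ] H) 1 + Z)) =
      (Ring.inverse (algebraMap ℝ (K →L[ℂ] K) 1 + Y)).comp A := by
    ext x
    -- The two quadratic forms as continuous `ℝ`-linear functionals, to be moved inside integrals.
    let φ : (H →L[ℂ] H) →L[ℝ] ℝ := Complex.reCLM.comp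
      (((innerSL ℂ (B x)).comp (apply ℂ H x)).restrictScalars ℝ)
    let ψ : (K →L[ℂ] K) →L[ℝ] ℝ := Complex.reCLM.comp
      (((innerSL ℂ (A x)).comp (apply ℂ K (A x))).restrictScalars ℝ)
    have hφ : ∀ T, φ T = RCLike.re ⟪T x, B x⟫_ℂ := fun T => inner_re_symm (𝕜 := ℂ) _ _
    have hψ : ∀ T, ψ T = RCLike.re ⟪T (A x), A x⟫_ℂ := fun T => inner_re_symm (𝕜 := ℂ) _ _
    let g : ℝ → ℝ := fun t => φ (cfc (rpowIntegrand₀₁ p t) Z) - ψ (cfc (rpowIntegrand₀₁ p t) Y)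
    have hg0 : ∀ t ∈ Ioi (0 : ℝ), 0 ≤ g t := fun t ht => by
      have := key x t ht
      rw [← hφ, ← hψ] at this
      exact le_trans (mul_nonneg (rpow_nonneg (le_of_lt ht) _) (by positivity)) this
    have hgc : ContinuousOn g (Ioi 0) :=
      (φ.continuous.comp_continuousOn (continuousOn_cfc_rpowIntegrand₀₁ Z hZ hp)).sub
        (ψ.continuous.comp_continuousOn (continuousOn_cfc_rpowIntegrand₀₁ Y hY hp))
    obtain ⟨hi1, hI1⟩ := integral_cfc_rpowIntegrand₀₁ Z hZ hp
    obtain ⟨hi2, hI2⟩ := integral_cfc_rpowIntegrand₀₁ Y hY hp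
    have hgi : IntegrableOn g (Ioi 0) := (φ.integrable_comp hi1).sub (ψ.integrable_comp hi2)
    have hI : ∫ t in Ioi 0, g t = 0 := by
      rw [integral_sub (φ.integrable_comp hi1) (ψ.integrable_comp hi2),
        φ.integral_comp_comm hi1, ψ.integral_comp_comm hi2, hI1, hI2, map_smul, map_smul,
        ← smul_sub, hφ, hψ]
      have hB : 0 ≤ B :=
        le_trans ((nonneg_iff_isPositive _).2 (isPositive_adjoint_comp_self A)) hAB
      have e : ⟪(Z ^ p) x, B x⟫_ℂ = ⟪(Y ^ p) (A x), A x⟫_ℂ := by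
        rw [← adjoint_inner_left A,
          ← ((nonneg_iff_isPositive _).1 hB).inner_left_eq_inner_right]
        exact congrArg (inner ℂ · x) (DFunLike.congr_fun hYZp x).symm
      rw [e, sub_self, smul_zero]
    -- A nonnegative function with integral zero vanishes almost everywhere, and by continuity
    -- everywhere: thus a single `t` serves all vectors `x`.
    have hae : g =ᵐ[volume.restrict (Ioi 0)] 0 :=
      (setIntegral_eq_zero_iff_of_nonneg_ae
        (ae_restrict_of_forall_mem measurableSet_Ioi hg0) hgi).1 hI
    have h1 : g 1 = 0 :=
      Measure.eqOn_open_of_ae_eq hae isOpen_Ioi hgc continuousOn_const (mem_Ioi.2 one_pos)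
    have h2 := key x 1 one_pos
    rw [← hφ, ← hψ] at h2
    have h3 := h2.trans_eq h1
    simp only [one_rpow, one_pow, one_mul] at h3
    have h4 := pow_eq_zero_iff (two_ne_zero) |>.1 (le_antisymm h3 (sq_nonneg _))
    exact sub_eq_zero.1 (norm_eq_zero.1 h4)
  have hS := Ring.inverse_mul_cancel _ (isUnit_algebraMap_add Z hZ one_pos)
  have hR := Ring.mul_inverse_cancel _ (isUnit_algebraMap_add Y hY one_pos)
  set T := algebraMap ℝ (H →L[ℂ] H) 1 + Z with hT
  set U := algebraMap ℝ (K →L[ℂ] K) 1 + Y with hU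
  have h : A.comp T = U.comp A := by
    calc A.comp T = (U * Ring.inverse U).comp (A.comp T) := by rw [hR]; rfl
      _ = U.comp (((Ring.inverse U).comp A).comp T) := rfl
      _ = U.comp (A.comp (Ring.inverse T * T)) := by rw [← heq]; rfl
      _ = U.comp A := by rw [hS]; rfl
  ext x
  simpa [hT, hU] using DFunLike.congr_fun h x

end Equality

theorem mainTheorem3 {H K : Type*}
    [NormedAddCommGroup H] [InnerProductSpace ℂ H] [CompleteSpace H]
    [NormedAddCommGroup K] [InnerProductSpace ℂ K] [CompleteSpace K]
    (A : H →L[ℂ] K) (B : H →L[ℂ] H) (C : K →L[ℂ] K) (hB : 0 ≤ B) (hC : 0 ≤ C)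
    (α β : ℝ) (hα : 0 < α) (hβ : 0 < β) (hαβ : α ≠ β) :
    ((ContinuousLinearMap.adjoint A).comp A ≤ B ∧
      (ContinuousLinearMap.adjoint A).comp ((C ^ α).comp A) = B ^ (α + 1) ∧
      (ContinuousLinearMap.adjoint A).comp ((C ^ β).comp A) = B ^ (β + 1)) ↔
    ((ContinuousLinearMap.adjoint A).comp A = B ∧ A.comp B = C.comp A) := by
  constructor
  · rintro ⟨h1, hAα, hAβ⟩
    wlog hlt : α < β generalizing α β
    · exact this β α hβ hα hαβ.symm hAβ hAα (lt_of_le_of_ne (not_lt.1 hlt) hαβ.symm)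
    rw [CFC.rpow_add_one_of_nonneg B hB hα] at hAα
    rw [CFC.rpow_add_one_of_nonneg B hB hβ] at hAβ
    have hp : α / β ∈ Set.Ioo 0 1 := ⟨by positivity, (div_lt_one hβ).2 hlt⟩
    have hβp : β * (α / β) = α := by field_simp
    have hB' : (B ^ β) ^ (α / β) = B ^ α := by
      rw [CFC.rpow_rpow_of_exponent_nonneg B _ _ hβ.le hp.1.le hB, hβp]
    have hC' : (C ^ β) ^ (α / β) = C ^ α := by
      rw [CFC.rpow_rpow_of_exponent_nonneg C _ _ hβ.le hp.1.le hC, hβp]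
    have hβi : 0 < β⁻¹ := inv_pos.2 hβ
    have hBi : (B ^ β) ^ β⁻¹ = B := by
      rw [CFC.rpow_rpow_of_exponent_nonneg B _ _ hβ.le hβi.le hB, mul_inv_cancel₀ hβ.ne',
        CFC.rpow_one B hB]
    have hCi : (C ^ β) ^ β⁻¹ = C := by
      rw [CFC.rpow_rpow_of_exponent_nonneg C _ _ hβ.le hβi.le hC, mul_inv_cancel₀ hβ.ne',
        CFC.rpow_one C hC]
    have hint : A.comp (B ^ β) = (C ^ β).comp A :=
      comp_eq_of_adjoint_comp_rpow_comp_eq A B (B ^ β) (C ^ β) CFC.rpow_nonneg CFC.rpow_nonneg h1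
        hAβ hp (by rw [hB', hC', hAα])
    have hAB : A.comp B = C.comp A := by
      have := rpow_comp_of_comp_eq A _ _ CFC.rpow_nonneg CFC.rpow_nonneg hint hβi
      rwa [hBi, hCi] at this
    refine ⟨?_, hAB⟩
    obtain ⟨G, hG⟩ : ∃ G, G = B - (ContinuousLinearMap.adjoint A).comp A := ⟨_, rfl⟩
    have hG0 : 0 ≤ G := by rw [hG]; exact sub_nonneg.2 h1
    have hGB : G ≤ B := by
      rw [hG]
      exact sub_le_self _ ((ContinuousLinearMap.nonneg_iff_isPositive _).2
        (ContinuousLinearMap.isPositive_adjoint_comp_self A))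
    have hGs : IsSelfAdjoint G := .of_nonneg hG0
    -- Indeed `A⋆ A Bᵝ = A⋆ Cᵝ A = B Bᵝ`.
    have hGβ : G.comp (B ^ β) = (0 : H →L[ℂ] H).comp G := by
      rw [hG, ContinuousLinearMap.sub_comp, ContinuousLinearMap.comp_assoc, hint, hAβ,
        ContinuousLinearMap.zero_comp]
      exact sub_self _
    -- `G` intertwines `B ^ β` and `0`, hence also their `β⁻¹`-th powers `B` and `0`.
    have hGBz : G * B = 0 := by
      have := rpow_comp_of_comp_eq G _ _ CFC.rpow_nonneg le_rfl hGβ hβi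
      rw [hBi] at this
      exact this.trans (by
        rw [show (0 : H →L[ℂ] H) ^ β⁻¹ = 0 from CFC.zero_rpow hβi.ne',
          ContinuousLinearMap.zero_comp])
    have hG3 : G * G * G = 0 := by
      refine le_antisymm ?_ (hGs.conjugate_nonneg hG0)
      calc G * G * G ≤ G * B * G := hGs.conjugate_le_conjugate hGB
        _ = 0 := by rw [hGBz, zero_mul]
    have hGz : G = 0 := by
      -- The C⋆-identity, applied to `G` and to `G * G`.
      rw [← CStarRing.star_mul_self_eq_zero_iff, hGs.star_eq,
        ← CStarRing.star_mul_self_eq_zero_iff, star_mul, hGs.star_eq, ← mul_assoc, hG3, zero_mul]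
    exact (sub_eq_zero.1 (hG ▸ hGz)).symm
  · rintro ⟨h1, h2⟩
    have h (s : ℝ) (hs : 0 < s) :
        (ContinuousLinearMap.adjoint A).comp ((C ^ s).comp A) = B ^ (s + 1) := by
      rw [← rpow_comp_of_comp_eq A B C hB hC h2 hs, ← ContinuousLinearMap.comp_assoc, h1,
        CFC.rpow_add_one_of_nonneg B hB hs]
      rfl
    exact ⟨h1.le, h α hα, h β hβ⟩
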